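/- Let $\mathcal{A}$ be a finite set of quantum systems, where each $v\in\mathcal{A}$ has a finite-dimensional Hilbert space $\mathcal{H}_v=\mathbb{C}^{d_v}$, and let $\rho$ be a density operator (positive semidefinite, of trace one) on $\mathcal{H}_{\mathcal{A}}=\bigotimes_{v\in\mathcal{A}}\mathcal{H}_v$. For $J\subseteq\mathcal{A}$ let $\rho_J$ be the marginal of $\rho$ on $\bigotimes_{v\in J}\mathcal{H}_v$, i.e. the partial trace of $\rho$ over the systems outside $J$. For a density operator $\sigma$ and $q>1$ let $S_q(\sigma)=\frac{1}{1-q}\left(\operatorname{Tr}\sigma^q-1\right)$ be the Tsallis entropy, and let $S_1(\sigma)=-\operatorname{Tr}\sigma\log\sigma$ be the von Neumann entropy. For $q\ge 1$ and $J\subseteq\mathcal{A}$ the $q$-deformed total correlation is $$C_q(J)_\rho=\sum_{v\in J}S_q(\rho_{\{v\}})-S_q(\rho_J).$$ Then, for every $q\ge 1$: 1. $C_q(I)_\rho\le C_q(J)_\rho$ whenever $I\subseteq J\subseteq\mathcal{A}$. 2. The sublevel sets $G(\varepsilon)_\rho=\{\varnothing\ne J\subseteq\mathcal{A} : C_q(J)_\rho\le\varepsilon\}$,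 $\varepsilon\in\mathbb{R}$, form a filtration of abstract simplicial complexes: each $G(\varepsilon)_\rho$ is closed under taking nonempty subsets of its members, and $G(\varepsilon)_\rho\subseteq G(\varepsilon')_\rho$ whenever $\varepsilon\le\varepsilon'$. -/

import Mathlib

open scoped ComplexOrder

/-- A quantum state (density operator) on the Hilbert space `ℂ^n` with orthonormal basis indexed
by the finite type `n`: a positive semidefinite matrix of trace one. -/
structure DensityMatrix (n : Type*) [Fintype n] where
  /-- The underlying complex matrix. -/
  toMatrix : Matrix n n ℂ
  posSemidef : toMatrix.PosSemidef
  trace_eq_one : toMatrix.trace = 1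

namespace DensityMatrix

section Entropy

variable {n : Type*} [Fintype n] [DecidableEq n]

/-- The von Neumann entropy `-Tr (ρ log ρ)`. The matrix `-ρ log ρ` is the function
`x ↦ -x log x` (with value `0` at `0`) applied to `ρ` by the functional calculus. -/
noncomputable def vonNeumannEntropy (ρ : DensityMatrix n) : ℝ :=
  (cfc Real.negMulLog ρ.toMatrix).trace.re

/-- The Tsallis entropy `S_q(ρ) = (Tr ρ^q - 1) / (1 - q)`; at `q = 1` it is the von Neumann
entropy, the limit of this expression as `q → 1`. The power `ρ^q` is the function `x ↦ x^q`
applied to `ρ` by the functional calculus. -/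
noncomputable def tsallisEntropy (q : ℝ) (ρ : DensityMatrix n) : ℝ :=
  if q = 1 then ρ.vonNeumannEntropy
  else 1 / (1 - q) * ((cfc (fun x : ℝ => x ^ q) ρ.toMatrix).trace.re - 1)

end Entropy

section Multipartite

variable {V : Type*} [Fintype V] [DecidableEq V] {d : V → Type*} [∀ v, Fintype (d v)]

/-- The marginal (reduced state) `ρ_J` of a state `ρ` on the tensor product of the `ℂ^(d v)`,
`v : V`: the partial trace over all the systems outside `J`. The tensor product has the product
basis, indexed by `∀ v, d v`. -/
def marginal (ρ : DensityMatrix (∀ v, d v)) (J : Finset V) :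
    DensityMatrix (∀ v : {v // v ∈ J}, d v) where
  toMatrix := Matrix.of fun a b => ∑ c : ∀ v : {v // ¬ v ∈ J}, d v,
    ρ.toMatrix ((Equiv.piEquivPiSubtypeProd (fun v => v ∈ J) d).symm (a, c))
      ((Equiv.piEquivPiSubtypeProd (fun v => v ∈ J) d).symm (b, c))
  posSemidef := by
    have h : (Matrix.of fun a b => ∑ c : ∀ v : {v // ¬ v ∈ J}, d v,
        ρ.toMatrix ((Equiv.piEquivPiSubtypeProd (fun v => v ∈ J) d).symm (a, c))
          ((Equiv.piEquivPiSubtypeProd (fun v => v ∈ J) d).symm (b, c))) =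
        ∑ c : ∀ v : {v // ¬ v ∈ J}, d v, ρ.toMatrix.submatrix
          (fun a => (Equiv.piEquivPiSubtypeProd (fun v => v ∈ J) d).symm (a, c))
          (fun a => (Equiv.piEquivPiSubtypeProd (fun v => v ∈ J) d).symm (a, c)) := by
      ext a b
      simp [Matrix.sum_apply]
    rw [h]
    exact Matrix.posSemidef_sum _ fun c _ => ρ.posSemidef.submatrix _
  trace_eq_one := by
    rw [← ρ.trace_eq_one]
    simp only [Matrix.trace, Matrix.diag_apply, Matrix.of_apply]
    rw [← Fintype.sum_prod_type'
      (f := fun a c => ρ.toMatrix ((Equiv.piEquivPiSubtypeProd (fun v => v ∈ J) d).symm (a, c))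
        ((Equiv.piEquivPiSubtypeProd (fun v => v ∈ J) d).symm (a, c)))]
    exact Equiv.sum_comp (Equiv.piEquivPiSubtypeProd (fun v => v ∈ J) d).symm
      (fun x => ρ.toMatrix x x)

variable [∀ v, DecidableEq (d v)]

/-- The `q`-deformed total correlation `C_q(J)_ρ = ∑_{v ∈ J} S_q(ρ_v) - S_q(ρ_J)`. -/
noncomputable def totalCorrelation (q : ℝ) (ρ : DensityMatrix (∀ v, d v)) (J : Finset V) : ℝ :=
  ∑ v ∈ J, (ρ.marginal {v}).tsallisEntropy q - (ρ.marginal J).tsallisEntropy q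

end Multipartite

end DensityMatrix

/-- The sublevel set `{J ∈ Δ : F J ≤ ε}` of a functional on the full simplex `Δ = 2^V \ {∅}`. -/
def sublevelFaces {V : Type*} (F : Finset V → ℝ) (ε : ℝ) : Set (Finset V) :=
  {J | J.Nonempty ∧ F J ≤ ε}

/-! Enlarging `J` by one system `w` changes `C_q` by `S_q(ρ_w) + S_q(ρ_J) - S_q(ρ_{J ∪ w})`, so
everything rests on subadditivity of `S_q` for `q ≥ 1`. To prove it, read a bipartite state in the
product of the eigenbases of its two marginals. Its diagonal there is a joint distribution whose
marginals are the two spectra, and by Peierls' inequality (`PosSemidef.sum_eigenvalues_le_sum_diag`)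
its entropy is at least that of the state. The classical inequality `sum_joint_le_sum_marginals`
then finishes; it needs only concavity of `tsallisFun q` and `tsallisFun_mul_le`. -/

/-! ### Classical entropy: the scalar function and joint distributions. -/

/-- The function `x ↦ (x - x ^ q) / (q - 1)`, read as `x ↦ -x log x` at `q = 1`, whose sum over
the spectrum of a state is the Tsallis entropy. -/
noncomputable def tsallisFun (q x : ℝ) : ℝ :=
  if q = 1 then Real.negMulLog x else (x - x ^ q) / (q - 1)

theorem concaveOn_tsallisFun {q : ℝ} (hq : 1 ≤ q) :
    ConcaveOn ℝ (Set.Ici 0) (tsallisFun q) := by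
  by_cases h : q = 1
  · have : tsallisFun q = Real.negMulLog := by
      ext x
      simp [tsallisFun, h]
    rw [this]
    exact Real.concaveOn_negMulLog
  · have h1 : 0 ≤ (q - 1)⁻¹ := inv_nonneg.2 (by linarith)
    have : tsallisFun q = fun x => (q - 1)⁻¹ • (x - x ^ q) := by
      ext x
      simp [tsallisFun, h, div_eq_inv_mul]
    rw [this]
    exact ((concaveOn_id (convex_Ici 0)).sub (convexOn_rpow hq)).smul h1

theorem tsallisFun_zero {q : ℝ} (hq : 1 ≤ q) : tsallisFun q 0 = 0 := by
  unfold tsallisFun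
  split_ifs
  · simp
  · rw [Real.zero_rpow (by linarith)]
    simp

/-- For `q ≠ 1` the gap is `(x - x ^ q) * (t - t ^ q) / (q - 1)`, and both factors are nonnegative
on `[0, 1]`; for `q = 1` the gap is zero. -/
theorem tsallisFun_mul_le {q : ℝ} (hq : 1 ≤ q) {x t : ℝ} (hx : x ∈ Set.Icc (0 : ℝ) 1)
    (ht : t ∈ Set.Icc (0 : ℝ) 1) :
    tsallisFun q (x * t) ≤ x * tsallisFun q t + t * tsallisFun q x := by
  unfold tsallisFun
  split_ifs with h
  · rw [Real.negMulLog_mul]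
    linarith
  · have hq1 : 0 < q - 1 := lt_of_le_of_ne (by linarith) fun h' => h (by linarith)
    have key : ∀ y ∈ Set.Icc (0 : ℝ) 1, y ^ q ≤ y := fun y hy => by
      simpa using Real.rpow_le_rpow_of_exponent_ge_of_imp hy.1 hy.2 hq (by intros; linarith)
    have hxq := key x hx
    have htq := key t ht
    rw [Real.mul_rpow hx.1 ht.1, mul_div_assoc', mul_div_assoc', ← add_div]
    gcongr
    nlinarith [mul_nonneg (sub_nonneg.2 hxq) (sub_nonneg.2 htq)]

/-- Subadditivity of the entropy `∑ f` of a joint probability distribution. -/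
theorem sum_joint_le_sum_marginals {m n : Type*} [Fintype m] [Fintype n] {f : ℝ → ℝ}
    (hf : ConcaveOn ℝ (Set.Ici 0) f) (hf0 : 0 ≤ f 0)
    (hmul : ∀ x ∈ Set.Icc (0 : ℝ) 1, ∀ t ∈ Set.Icc (0 : ℝ) 1, f (x * t) ≤ x * f t + t * f x)
    {p : m → n → ℝ} (hp : ∀ i j, 0 ≤ p i j) {x : m → ℝ} {y : n → ℝ}
    (hx : ∀ i, ∑ j, p i j = x i) (hy : ∀ j, ∑ i, p i j = y j) (hx1 : ∑ i, x i = 1) :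
    ∑ i, ∑ j, f (p i j) ≤ ∑ i, f (x i) + ∑ j, f (y j) := by
  have hx0 : ∀ i, 0 ≤ x i := fun i => hx i ▸ Finset.sum_nonneg fun j _ => hp i j
  have hxle : ∀ i, x i ≤ 1 := fun i =>
    hx1 ▸ Finset.single_le_sum (fun i _ => hx0 i) (Finset.mem_univ i)
  have hpx : ∀ i j, p i j ≤ x i := fun i j =>
    hx i ▸ Finset.single_le_sum (fun j _ => hp i j) (Finset.mem_univ j)
  -- The ratio `p i j / x i` is the conditional probability of `j` given `i`. If `x i = 0` it is `0`
  -- by convention, and `p i j = 0` too.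
  have hmulp : ∀ i j, x i * (p i j / x i) = p i j := fun i j => by
    rcases eq_or_ne (x i) 0 with h | h
    · have := hpx i j
      have := hp i j
      rw [h]
      linarith
    · field_simp
  have ht : ∀ i j, p i j / x i ∈ Set.Icc (0 : ℝ) 1 := fun i j =>
    ⟨div_nonneg (hp i j) (hx0 i), div_le_one_of_le₀ (hpx i j) (hx0 i)⟩
  -- The conditional weights sum to `1`, or to `0` when `x i = 0`; the second case is where `0 ≤ f
  -- 0` enters.
  have hrow : ∀ i, ∑ j, p i j / x i * f (x i) ≤ f (x i) := fun i => by
    rw [← Finset.sum_mul, ← Finset.sum_div, hx]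
    rcases eq_or_ne (x i) 0 with h | h
    · simpa [h] using hf0
    · simp [h]
  -- Jensen: averaging the conditionals with weights `x i` gives `y j`.
  have hcol : ∀ j, ∑ i, x i * f (p i j / x i) ≤ f (y j) := fun j => by
    have := hf.le_map_sum (t := Finset.univ) (w := x) (p := fun i => p i j / x i)
      (fun i _ => hx0 i) hx1 fun i _ => (ht i j).1
    simpa [hmulp, hy] using this
  calc ∑ i, ∑ j, f (p i j)
      ≤ ∑ i, ∑ j, (x i * f (p i j / x i) + p i j / x i * f (x i)) := by
        gcongr with i _ j _
        simpa [hmulp] using hmul (x i) ⟨hx0 i, hxle i⟩ _ (ht i j)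
    _ = ∑ i, ∑ j, p i j / x i * f (x i) + ∑ j, ∑ i, x i * f (p i j / x i) := by
        rw [Finset.sum_comm (s := (Finset.univ : Finset n)), ← Finset.sum_add_distrib]
        exact Finset.sum_congr rfl fun i _ => by rw [Finset.sum_add_distrib, add_comm]
    _ ≤ _ := add_le_add (Finset.sum_le_sum fun i _ => hrow i) (Finset.sum_le_sum fun j _ => hcol j)

/-! ### Spectral sums, diagonals and partial traces of matrices. -/

namespace Matrix

theorem IsHermitian.trace_cfc {n : Type*} [Fintype n] [DecidableEq n] {A : Matrix n n ℂ}
    (hA : A.IsHermitian) (f : ℝ → ℝ) :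
    (cfc f A).trace = ((∑ i, f (hA.eigenvalues i) : ℝ) : ℂ) := by
  rw [hA.cfc_eq, IsHermitian.cfc, Unitary.conjStarAlgAut_apply, trace_mul_cycle,
    Unitary.coe_star_mul_self, one_mul, trace_diagonal]
  simp

/-- Peierls' inequality: the diagonal of a positive semidefinite matrix in any orthonormal basis
has larger entropy than the spectrum. -/
theorem PosSemidef.sum_eigenvalues_le_sum_diag {n ι : Type*} [Fintype n] [DecidableEq n]
    [Fintype ι] [DecidableEq ι] {A : Matrix n n ℂ} (hA : A.PosSemidef) {f : ℝ → ℝ}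
    (hf : ConcaveOn ℝ (Set.Ici 0) f) {U : Matrix n ι ℂ} (hU : Uᴴ * U = 1) (hU' : U * Uᴴ = 1) :
    ∑ k, f (hA.1.eigenvalues k) ≤ ∑ i, f ((Uᴴ * A * U) i i).re := by
  set W : Matrix n n ℂ := (hA.1.eigenvectorUnitary).1 with hW
  have hWW : W * Wᴴ = 1 := Unitary.coe_mul_star_self hA.1.eigenvectorUnitary
  have hWW' : Wᴴ * W = 1 := Unitary.coe_star_mul_self hA.1.eigenvectorUnitary
  have hspec : A = W * diagonal (fun k => (hA.1.eigenvalues k : ℂ)) * Wᴴ := by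
    conv_lhs => rw [hA.1.spectral_theorem, Unitary.conjStarAlgAut_apply]
    rfl
  set M : Matrix ι n ℂ := Uᴴ * W with hM
  have hMM : M * Mᴴ = 1 := by
    rw [hM, conjTranspose_mul, conjTranspose_conjTranspose, Matrix.mul_assoc,
      ← Matrix.mul_assoc W, hWW, Matrix.one_mul, hU]
  have hMM' : Mᴴ * M = 1 := by
    rw [hM, conjTranspose_mul, conjTranspose_conjTranspose, Matrix.mul_assoc,
      ← Matrix.mul_assoc U, hU', Matrix.one_mul, hWW']
  -- The matrix `|M i k|²` is doubly stochastic: row sums allow Jensen at each diagonal entry,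
  -- column sums recover the sum over the spectrum.
  have hrow : ∀ i, ∑ k, Complex.normSq (M i k) = 1 := fun i => by
    have := congrFun (congrFun hMM i) i
    simp only [mul_apply, conjTranspose_apply, one_apply_eq, RCLike.star_def,
      Complex.mul_conj] at this
    exact_mod_cast this
  have hcol : ∀ k, ∑ i, Complex.normSq (M i k) = 1 := fun k => by
    have := congrFun (congrFun hMM' k) k
    simp only [mul_apply, conjTranspose_apply, one_apply_eq, RCLike.star_def,
      ← Complex.normSq_eq_conj_mul_self] at this
    exact_mod_cast this
  have hdiag : ∀ i, ((Uᴴ * A * U) i i).re =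
      ∑ k, Complex.normSq (M i k) * hA.1.eigenvalues k := fun i => by
    have h1 : Uᴴ * A * U = M * diagonal (fun k => (hA.1.eigenvalues k : ℂ)) * Mᴴ := by
      conv_lhs => rw [hspec]
      simp only [hM, conjTranspose_mul, conjTranspose_conjTranspose, Matrix.mul_assoc]
    rw [h1, mul_apply, Complex.re_sum]
    refine Finset.sum_congr rfl fun k _ => ?_
    have h2 : M i k * star (M i k) = Complex.normSq (M i k) := Complex.mul_conj _
    rw [mul_diagonal, conjTranspose_apply, mul_right_comm, h2, ← Complex.ofReal_mul, Complex.ofReal_re]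
  calc ∑ k, f (hA.1.eigenvalues k)
      = ∑ i, ∑ k, Complex.normSq (M i k) * f (hA.1.eigenvalues k) := by
        rw [Finset.sum_comm]
        exact Finset.sum_congr rfl fun k _ => by rw [← Finset.sum_mul, hcol, one_mul]
    _ ≤ _ := by
        refine Finset.sum_le_sum fun i _ => ?_
        rw [hdiag]
        simpa using hf.le_map_sum (t := Finset.univ) (w := fun k => Complex.normSq (M i k))
          (p := hA.1.eigenvalues) (fun k _ => Complex.normSq_nonneg _) (hrow i)
          fun k _ => hA.eigenvalues_nonneg k

open scoped Kronecker

/-- A partial trace may be taken in any orthonormal basis of the traced factor: `V * Vᴴ = 1` is the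
completeness relation that collapses the sum over `j`. -/
theorem sum_diag_kronecker_conj_right {m n : Type*} [Fintype m] [Fintype n] [DecidableEq n]
    (R : Matrix (m × n) (m × n) ℂ) (U : Matrix m m ℂ) {V : Matrix n n ℂ} (hV : V * Vᴴ = 1)
    (i : m) :
    ∑ j, ((U ⊗ₖ V)ᴴ * R * (U ⊗ₖ V)) (i, j) (i, j) =
      (Uᴴ * (of fun a a' => ∑ b, R (a, b) (a', b)) * U) i i := by
  have hV' : ∀ b b', ∑ j, V b' j * star (V b j) = if b' = b then 1 else 0 := fun b b' => by
    rw [← one_apply, ← hV, mul_apply]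
    rfl
  calc ∑ j, ((U ⊗ₖ V)ᴴ * R * (U ⊗ₖ V)) (i, j) (i, j)
      = ∑ y : m × n, ∑ x : m × n, star (U x.1 i) * R x y * U y.1 i *
          ∑ j, V y.2 j * star (V x.2 j) := by
        simp only [mul_apply, conjTranspose_apply, kroneckerMap_apply, Finset.sum_mul,
          Finset.mul_sum, star_mul']
        rw [Finset.sum_comm]
        refine Finset.sum_congr rfl fun y _ => ?_
        rw [Finset.sum_comm]
        refine Finset.sum_congr rfl fun x _ => Finset.sum_congr rfl fun j _ => ?_
        ring
    _ = _ := by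
        simp only [hV', Fintype.sum_prod_type, mul_ite, mul_one, mul_zero, Finset.sum_ite_eq,
          Finset.mem_univ, if_true, mul_apply, conjTranspose_apply, of_apply, Finset.sum_mul,
          Finset.mul_sum]
        refine Finset.sum_congr rfl fun a' _ => ?_
        rw [Finset.sum_comm]

theorem sum_diag_kronecker_conj_left {m n : Type*} [Fintype m] [Fintype n] [DecidableEq m]
    (R : Matrix (m × n) (m × n) ℂ) {U : Matrix m m ℂ} (V : Matrix n n ℂ) (hU : U * Uᴴ = 1)
    (j : n) :
    ∑ i, ((U ⊗ₖ V)ᴴ * R * (U ⊗ₖ V)) (i, j) (i, j) =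
      (Vᴴ * (of fun b b' => ∑ a, R (a, b) (a, b')) * V) j j := by
  have hswap : U ⊗ₖ V = (V ⊗ₖ U).submatrix (Equiv.prodComm m n) (Equiv.prodComm m n) := by
    ext x y
    simp [kroneckerMap_apply, mul_comm]
  have hR : R = (R.submatrix (Equiv.prodComm n m) (Equiv.prodComm n m)).submatrix
      (Equiv.prodComm m n) (Equiv.prodComm m n) := by
    ext x y
    simp
  rw [hswap, hR, conjTranspose_submatrix, submatrix_mul_equiv, submatrix_mul_equiv]
  simpa using! sum_diag_kronecker_conj_right
    (R.submatrix (Equiv.prodComm n m) (Equiv.prodComm n m)) V hU j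

end Matrix

/-! ### Subadditivity of the quantum entropy. -/

namespace DensityMatrix

open scoped Kronecker Matrix

section Entropy

variable {n : Type*} [Fintype n] [DecidableEq n]

theorem sum_eigenvalues_eq_one (ρ : DensityMatrix n) : ∑ i, ρ.posSemidef.1.eigenvalues i = 1 := by
  have := ρ.posSemidef.1.trace_eq_sum_eigenvalues
  rw [ρ.trace_eq_one] at this
  exact Complex.ofReal_injective (by simpa using this.symm)

/-- Trace one turns the constant `1` into the sum of the eigenvalues, so that one function is summed
over the spectrum. -/
theorem tsallisEntropy_eq_sum (ρ : DensityMatrix n) (q : ℝ) :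
    ρ.tsallisEntropy q = ∑ i, tsallisFun q (ρ.posSemidef.1.eigenvalues i) := by
  unfold tsallisEntropy tsallisFun
  split_ifs with h
  · rw [vonNeumannEntropy, ρ.posSemidef.1.trace_cfc, Complex.ofReal_re]
  · rw [ρ.posSemidef.1.trace_cfc, Complex.ofReal_re, ← Finset.sum_div, Finset.sum_sub_distrib,
      sum_eigenvalues_eq_one]
    have h1 : q - 1 ≠ 0 := sub_ne_zero.2 h
    have h2 : 1 - q ≠ 0 := sub_ne_zero.2 (Ne.symm h)
    field_simp
    ring

/-- Subadditivity of the Tsallis entropy for a bipartite state. -/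
theorem tsallisEntropy_le_add {m N : Type*} [Fintype m] [DecidableEq m] [Fintype N]
    [DecidableEq N] {q : ℝ} (hq : 1 ≤ q) (ρ : DensityMatrix N) (ρA : DensityMatrix m)
    (ρB : DensityMatrix n) (e : m × n ≃ N)
    (hA : ∀ a a', ρA.toMatrix a a' = ∑ b, ρ.toMatrix (e (a, b)) (e (a', b)))
    (hB : ∀ b b', ρB.toMatrix b b' = ∑ a, ρ.toMatrix (e (a, b)) (e (a, b'))) :
    ρ.tsallisEntropy q ≤ ρA.tsallisEntropy q + ρB.tsallisEntropy q := by
  set U : Matrix m m ℂ := (ρA.posSemidef.1.eigenvectorUnitary).1 with hUdef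
  set V : Matrix n n ℂ := (ρB.posSemidef.1.eigenvectorUnitary).1 with hVdef
  have hU : U * Uᴴ = 1 := Unitary.coe_mul_star_self ρA.posSemidef.1.eigenvectorUnitary
  have hU' : Uᴴ * U = 1 := Unitary.coe_star_mul_self ρA.posSemidef.1.eigenvectorUnitary
  have hV : V * Vᴴ = 1 := Unitary.coe_mul_star_self ρB.posSemidef.1.eigenvectorUnitary
  have hV' : Vᴴ * V = 1 := Unitary.coe_star_mul_self ρB.posSemidef.1.eigenvectorUnitary
  set K := U ⊗ₖ V with hK
  have hKK : K * Kᴴ = 1 := by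
    rw [hK, Matrix.conjTranspose_kronecker, ← Matrix.mul_kronecker_mul, hU, hV,
      Matrix.one_kronecker_one]
  have hKK' : Kᴴ * K = 1 := by
    rw [hK, Matrix.conjTranspose_kronecker, ← Matrix.mul_kronecker_mul, hU', hV',
      Matrix.one_kronecker_one]
  set R := ρ.toMatrix.submatrix e e with hR
  have hRpos : (Kᴴ * R * K).PosSemidef :=
    (ρ.posSemidef.submatrix e).conjTranspose_mul_mul_same K
  have hρR : ρ.toMatrix = R.submatrix e.symm e.symm := by
    ext x y
    simp [hR]
  -- Only the rows of `K` are reindexed: its columns form a basis of `ℂ^N` still labelled by pairs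
  -- in `m × n`.
  have hconj : (K.submatrix e.symm id)ᴴ * ρ.toMatrix * K.submatrix e.symm id = Kᴴ * R * K := by
    rw [hρR, Matrix.conjTranspose_submatrix, Matrix.submatrix_mul_equiv,
      Matrix.submatrix_mul_equiv, Matrix.submatrix_id_id]
  have hpeierls := ρ.posSemidef.sum_eigenvalues_le_sum_diag (concaveOn_tsallisFun hq)
    (U := K.submatrix e.symm id)
    (by rw [Matrix.conjTranspose_submatrix, Matrix.submatrix_mul_equiv, hKK',
      Matrix.submatrix_id_id])
    (by
      have := Matrix.submatrix_mul_equiv K Kᴴ e.symm (Equiv.refl _) e.symm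
      rw [Matrix.conjTranspose_submatrix]
      simpa [hKK] using! this)
  rw [hconj, Fintype.sum_prod_type] at hpeierls
  have hdiagA : ∀ i, (Uᴴ * ρA.toMatrix * U) i i = ρA.posSemidef.1.eigenvalues i := fun i => by
    have := congrFun (congrFun ρA.posSemidef.1.conjStarAlgAut_star_eigenvectorUnitary i) i
    rw [Unitary.conjStarAlgAut_star_apply, Matrix.diagonal_apply_eq] at this
    exact this
  have hdiagB : ∀ j, (Vᴴ * ρB.toMatrix * V) j j = ρB.posSemidef.1.eigenvalues j := fun j => by
    have := congrFun (congrFun ρB.posSemidef.1.conjStarAlgAut_star_eigenvectorUnitary j) j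
    rw [Unitary.conjStarAlgAut_star_apply, Matrix.diagonal_apply_eq] at this
    exact this
  have hA' : ρA.toMatrix = Matrix.of fun a a' => ∑ b, R (a, b) (a', b) := by
    ext a a'
    simp [hA, hR]
  have hB' : ρB.toMatrix = Matrix.of fun b b' => ∑ a, R (a, b) (a, b') := by
    ext b b'
    simp [hB, hR]
  rw [tsallisEntropy_eq_sum, tsallisEntropy_eq_sum, tsallisEntropy_eq_sum]
  refine hpeierls.trans (sum_joint_le_sum_marginals (concaveOn_tsallisFun hq)
    (tsallisFun_zero hq).ge (fun x hx t ht => tsallisFun_mul_le hq hx ht)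
    (p := fun i j => ((Kᴴ * R * K) (i, j) (i, j)).re) (fun i j => ?_) (fun i => ?_) (fun j => ?_)
    ρA.sum_eigenvalues_eq_one)
  · exact (Complex.le_def.1 (hRpos.diag_nonneg (i := (i, j)))).1
  · rw [← Complex.re_sum, Matrix.sum_diag_kronecker_conj_right R U hV, ← hA', hdiagA,
      Complex.ofReal_re]
  · rw [← Complex.re_sum, Matrix.sum_diag_kronecker_conj_left R V hU, ← hB', hdiagB,
      Complex.ofReal_re]

end Entropy

/-! ### Marginals of multipartite states and monotonicity. -/

section Multipartite

variable {V : Type*} [DecidableEq V] {d : V → Type*}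

/-- The configurations on a union of two disjoint sets of systems are the pairs of
configurations on the two sets. -/
def glueEquiv (d : V → Type*) {K L J : Finset V} (hJ : ∀ v, v ∈ J ↔ v ∈ K ∨ v ∈ L)
    (hKL : Disjoint K L) :
    (∀ v : {v // v ∈ K}, d v) × (∀ v : {v // v ∈ L}, d v) ≃ ∀ v : {v // v ∈ J}, d v where
  toFun x v := if h : v.1 ∈ K then x.1 ⟨v, h⟩ else x.2 ⟨v, ((hJ v).1 v.2).resolve_left h⟩
  invFun y := (fun v => y ⟨v, (hJ v).2 (.inl v.2)⟩, fun v => y ⟨v, (hJ v).2 (.inr v.2)⟩)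
  left_inv x := by
    refine Prod.ext (funext fun v => dif_pos v.2) (funext fun v => dif_neg fun h => ?_)
    exact Finset.disjoint_left.1 hKL h v.2
  right_inv y := by
    funext v
    dsimp only
    split_ifs <;> rfl

/-- The configurations on the complement of `K` are the pairs of configurations on `L` and on the
complement of `K ∪ L`. -/
def complGlueEquiv (d : V → Type*) {K L J : Finset V} (hJ : ∀ v, v ∈ J ↔ v ∈ K ∨ v ∈ L)
    (hKL : Disjoint K L) :
    (∀ v : {v // v ∈ L}, d v) × (∀ v : {v // ¬ v ∈ J}, d v) ≃ ∀ v : {v // ¬ v ∈ K}, d v where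
  toFun x v := if h : v.1 ∈ L then x.1 ⟨v, h⟩ else x.2 ⟨v, fun hv => ((hJ v).1 hv).elim v.2 h⟩
  invFun y := (fun v => y ⟨v, fun h => Finset.disjoint_left.1 hKL h v.2⟩,
    fun v => y ⟨v, fun h => v.2 ((hJ v).2 (.inl h))⟩)
  left_inv x := by
    refine Prod.ext (funext fun v => dif_pos v.2) (funext fun v => dif_neg fun h => ?_)
    exact v.2 ((hJ v).2 (.inr h))
  right_inv y := by
    funext v
    dsimp only
    split_ifs <;> rfl

variable [Fintype V] [∀ v, Fintype (d v)]

/-- Partial traces compose: the marginal on `K` is the partial trace over `L` of the marginal on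
`K ∪ L`. -/
theorem marginal_eq_sum_marginal (ρ : DensityMatrix (∀ v, d v)) {K L J : Finset V}
    (hJ : ∀ v, v ∈ J ↔ v ∈ K ∨ v ∈ L) (hKL : Disjoint K L) (a a' : ∀ v : {v // v ∈ K}, d v) :
    (ρ.marginal K).toMatrix a a' = ∑ b, (ρ.marginal J).toMatrix
      (glueEquiv d hJ hKL (a, b)) (glueEquiv d hJ hKL (a', b)) := by
  have key : ∀ (a : ∀ v : {v // v ∈ K}, d v) (b : ∀ v : {v // v ∈ L}, d v)
      (c : ∀ v : {v // ¬ v ∈ J}, d v),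
      (Equiv.piEquivPiSubtypeProd (fun v => v ∈ K) d).symm (a, complGlueEquiv d hJ hKL (b, c)) =
      (Equiv.piEquivPiSubtypeProd (fun v => v ∈ J) d).symm (glueEquiv d hJ hKL (a, b), c) := by
    intro a b c
    funext v
    have := hJ v
    by_cases h1 : v ∈ K <;> by_cases h2 : v ∈ L <;>
      simp_all [Equiv.piEquivPiSubtypeProd, glueEquiv, complGlueEquiv]
  simp only [marginal, Matrix.of_apply]
  -- The trace over the complement of `K` splits into one over `L` and one over the complement of
  -- `J`.
  rw [← Equiv.sum_comp (complGlueEquiv d hJ hKL), Fintype.sum_prod_type]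
  simp only [key]

variable [∀ v, DecidableEq (d v)]

theorem tsallisEntropy_marginal_le_add {q : ℝ} (hq : 1 ≤ q) (ρ : DensityMatrix (∀ v, d v))
    {K L J : Finset V} (hJ : ∀ v, v ∈ J ↔ v ∈ K ∨ v ∈ L) (hKL : Disjoint K L) :
    (ρ.marginal J).tsallisEntropy q ≤
      (ρ.marginal K).tsallisEntropy q + (ρ.marginal L).tsallisEntropy q := by
  refine tsallisEntropy_le_add hq _ _ _ (glueEquiv d hJ hKL)
    (ρ.marginal_eq_sum_marginal hJ hKL) fun b b' => ?_
  have hJ' : ∀ v, v ∈ J ↔ v ∈ L ∨ v ∈ K := fun v => (hJ v).trans or_comm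
  -- Gluing does not depend on the order of the disjoint sets, so the marginal on `L` follows from
  -- the same lemma with the roles exchanged.
  have hglue : ∀ a b, glueEquiv d hJ' hKL.symm (b, a) = glueEquiv d hJ hKL (a, b) := by
    intro a b
    funext ⟨v, hv⟩
    have h1 := (hJ v).1 hv
    have h2 : v ∈ K → v ∉ L := fun h => Finset.disjoint_left.1 hKL h
    by_cases hK : v ∈ K <;> simp_all [glueEquiv]
  simpa only [hglue] using ρ.marginal_eq_sum_marginal hJ' hKL.symm b b'

theorem totalCorrelation_mono {q : ℝ} (hq : 1 ≤ q) (ρ : DensityMatrix (∀ v, d v)) :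
    Monotone (ρ.totalCorrelation q) := by
  refine Finset.monotone_iff_forall_le_insert.2 fun J w hw => ?_
  have := ρ.tsallisEntropy_marginal_le_add hq (K := J) (L := {w}) (J := insert w J)
    (by simp [or_comm]) (by simpa using hw)
  rw [totalCorrelation, totalCorrelation, Finset.sum_insert hw]
  linarith

end Multipartite

end DensityMatrix

theorem isRelLowerSet_sublevelFaces {V : Type*} {F : Finset V → ℝ} (hF : Monotone F) (ε : ℝ) :
    IsRelLowerSet (sublevelFaces F ε) Finset.Nonempty :=
  fun _ hJ => ⟨hJ.1, fun _ hIJ hI => ⟨hI, (hF hIJ).trans hJ.2⟩⟩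

theorem mainTheorem7 {V : Type*} [Fintype V] [DecidableEq V]
    {d : V → Type*} [∀ v, Fintype (d v)] [∀ v, DecidableEq (d v)]
    (ρ : DensityMatrix (∀ v, d v)) (q : ℝ) (hq : 1 ≤ q) :
    (∀ I J : Finset V, I ⊆ J → ρ.totalCorrelation q I ≤ ρ.totalCorrelation q J) ∧
    ∃ G : ℝ →o PreAbstractSimplicialComplex V,
      ∀ ε : ℝ, (G ε).faces = sublevelFaces (ρ.totalCorrelation q) ε :=
  have hmono := ρ.totalCorrelation_mono hq
  ⟨fun _ _ h => hmono h,
    -- Singletons need not be faces here: they have total correlation `0`, so for `ε < 0` the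
    -- complex is empty.
    ⟨⟨fun ε => ⟨_, isRelLowerSet_sublevelFaces hmono ε⟩,
      fun _ _ hε _ hJ => ⟨hJ.1, hJ.2.trans hε⟩⟩, fun _ => rfl⟩⟩
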